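/- For complex $a,q$ with $|q|<1$ write $(a;q)_n=\prod_{k=0}^{n-1}(1-aq^k)$ for integers $n\ge 0$, $(a;q)_\infty=\prod_{k=0}^{\infty}(1-aq^k)$, and $(a_1,\dots,a_m;q)_n=(a_1;q)_n\cdots(a_m;q)_n$ for $0\le n\le\infty$. Let $q\in\mathbb{C}$ with $|q|<1$. (i) For every $z\in\mathbb{C}$ with $zq^{2k+1}\ne 1$ for all integers $k\ge 0$, the three series below converge absolutely and $$\sum_{n\ge 0}\frac{z^n q^{3n^2}}{(zq;q^2)_n(q^4;q^4)_n}=\frac{1}{(-q^2;q^2)_\infty}\sum_{n\ge 0}\frac{q^{n^2+n}}{(zq;q^2)_n(q^2;q^2)_n}=\frac{1}{(zq;q^2)_\infty}\sum_{n\ge 0}\frac{(-z)^n q^{n^2}}{(q^4;q^4)_n}.$$ (ii) (Rogers' identity) $$\sum_{n\ge 0}\frac{q^{n^2}}{(q^4;q^4)_n}=\frac{1}{(-q^2;q^2)_\infty(q,q^4;q^5)_\infty}.$$ (iii) Consequently, at $z=-1$ (equation (19) of Slater's list), $$\sum_{n\ge 0}\frac{(-1)^n q^{3n^2}}{(-q;q^2)_n(q^4;q^4)_n}=\frac{1}{(-q,-q^2;q^2)_\infty(q,q^4;q^5)_\infty}=\frac{1}{(-q;q)_\infty(q,q^4;q^5)_\infty}=\frac{(q;q)_\infty}{(q^2;q^2)_\infty(q,q^4;q^5)_\infty}=\frac{(q^2,q^3,q^5;q^5)_\infty}{(q^2;q^2)_\infty}.$$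 -/

import Mathlib

open scoped BigOperators

/-- The finite `q`-shifted factorial `(a;q)_n = ∏_{k=0}^{n-1} (1 - a q^k)`. -/
noncomputable def qPoch (a q : ℂ) (n : ℕ) : ℂ :=
  ∏ k ∈ Finset.range n, (1 - a * q ^ k)

/-- The infinite `q`-shifted factorial `(a;q)_∞ = ∏_{k=0}^∞ (1 - a q^k)`
(used only for `‖q‖ < 1`, where the product converges: see `tendsto_qPoch`). -/
noncomputable def qPochInf (a q : ℂ) : ℂ :=
  ∏' k : ℕ, (1 - a * q ^ k)

theorem multipliable_qPoch (a : ℂ) {q : ℂ} (hq : ‖q‖ < 1) :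
    Multipliable fun k : ℕ => 1 - a * q ^ k := by
  have h : Summable fun k : ℕ => ‖-(a * q ^ k)‖ := by
    simpa [norm_mul, norm_pow] using
      (summable_geometric_of_lt_one (norm_nonneg q) hq).mul_left ‖a‖
  simpa [sub_eq_add_neg] using multipliable_one_add_of_summable h

theorem tendsto_qPoch (a : ℂ) {q : ℂ} (hq : ‖q‖ < 1) :
    Filter.Tendsto (qPoch a q) Filter.atTop (nhds (qPochInf a q)) :=
  (multipliable_qPoch a hq).hasProd.tendsto_prod_nat

/-! ### Finite and infinite q-shifted factorials. -/

open Filter Topology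

/-! For (i), multiply the series by $(zq;q^2)_\infty$. Then
$(zq;q^2)_\infty/(zq;q^2)_n=(zq^{2n+1};q^2)_\infty$, which Euler's expansion (`qPochInf_eq_tsum`)
turns into an absolutely convergent double sum with coupling factor $q^{2nm}$. For the first series,
$3n^2+2nm+m^2=(n+m)^2+2n^2$, so summing along $n+m=N$ leaves a finite convolution. For the second,
exchanging the sums leaves an inner series that Euler's expansion sums to $(-q^{2m+2};q^2)_\infty$.

For (ii), the same device gives $(-q^2;q^2)_\infty\sum q^{n^2}/(q^4;q^4)_n=\sum q^{n^2}/(q;q)_n$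
(`qPochInf_mul_tsum_pow_sq_div`), so Rogers' identity reduces to the first Rogers–Ramanujan
identity. That one comes from two Bailey steps applied to the unit Bailey pair, the limit
$n\to\infty$, and the Jacobi triple product. Part (iii) is then (i) at $z=-1$ combined with product
dissections. -/

theorem qPoch_zero (a q : ℂ) : qPoch a q 0 = 1 := by simp [qPoch]

theorem qPoch_succ (a q : ℂ) (n : ℕ) : qPoch a q (n + 1) = qPoch a q n * (1 - a * q ^ n) := by
  simp [qPoch, Finset.prod_range_succ]

theorem qPoch_add (a q : ℂ) (m n : ℕ) :
    qPoch a q (m + n) = qPoch a q m * qPoch (a * q ^ m) q n := by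
  simp only [qPoch, Finset.prod_range_add, pow_add, mul_assoc]

theorem qPoch_ne_zero {a q : ℂ} (h : ∀ k : ℕ, 1 - a * q ^ k ≠ 0) (n : ℕ) : qPoch a q n ≠ 0 :=
  Finset.prod_ne_zero_iff.mpr fun k _ => h k

theorem qPochInf_ne_zero {a q : ℂ} (hq : ‖q‖ < 1) (h : ∀ k : ℕ, 1 - a * q ^ k ≠ 0) :
    qPochInf a q ≠ 0 := by
  have hs : Summable fun k : ℕ => ‖-(a * q ^ k)‖ := by
    simpa [norm_mul, norm_pow] using
      (summable_geometric_of_lt_one (norm_nonneg q) hq).mul_left ‖a‖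
  have := tprod_one_add_ne_zero_of_summable (f := fun k : ℕ => -(a * q ^ k))
    (fun k => by simpa [sub_eq_add_neg] using h k) hs
  simpa [qPochInf, sub_eq_add_neg] using this

theorem qPochInf_eq_mul (a : ℂ) {q : ℂ} (hq : ‖q‖ < 1) (n : ℕ) :
    qPochInf a q = qPoch a q n * qPochInf (a * q ^ n) q := by
  have h1 : Tendsto (fun k => qPoch a q (n + k)) atTop (𝓝 (qPochInf a q)) := by
    simpa [add_comm] using (tendsto_add_atTop_iff_nat n).mpr (tendsto_qPoch a hq)
  have h2 := (tendsto_qPoch (a * q ^ n) hq).const_mul (qPoch a q n)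
  simp only [qPoch_add] at h1
  exact tendsto_nhds_unique h1 h2

/-- The factors are sorted by the residue of their exponent modulo `m`. -/
theorem qPoch_mul_length (a q : ℂ) (m n : ℕ) :
    qPoch a q (m * n) = ∏ i ∈ Finset.range m, qPoch (a * q ^ i) (q ^ m) n := by
  induction n with
  | zero => simp [qPoch]
  | succ n ih =>
    rw [Nat.mul_succ, qPoch_add, ih]
    simp only [qPoch_succ, Finset.prod_mul_distrib]
    congr 1
    simp only [qPoch, ← pow_mul]
    exact Finset.prod_congr rfl fun i _ => by ring

theorem norm_pow_lt_one {q : ℂ} (hq : ‖q‖ < 1) {m : ℕ} (hm : m ≠ 0) : ‖q ^ m‖ < 1 := by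
  rw [norm_pow]; exact pow_lt_one₀ (norm_nonneg _) hq hm

/-- Dissection of an infinite `q`-shifted factorial modulo `m`. -/
theorem qPochInf_eq_prod (a : ℂ) {q : ℂ} (hq : ‖q‖ < 1) {m : ℕ} (hm : m ≠ 0) :
    qPochInf a q = ∏ i ∈ Finset.range m, qPochInf (a * q ^ i) (q ^ m) := by
  have h1 : Tendsto (fun n => qPoch a q (m * n)) atTop (𝓝 (qPochInf a q)) :=
    (tendsto_qPoch a hq).comp (tendsto_id.const_mul_atTop' (Nat.pos_of_ne_zero hm))
  simp only [qPoch_mul_length] at h1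
  exact tendsto_nhds_unique h1
    (tendsto_finsetProd _ fun i _ => tendsto_qPoch _ (norm_pow_lt_one hq hm))

theorem qPoch_mul_qPoch_neg (a q : ℂ) (n : ℕ) :
    qPoch a q n * qPoch (-a) q n = qPoch (a ^ 2) (q ^ 2) n := by
  simp only [qPoch, ← Finset.prod_mul_distrib, ← pow_mul]
  exact Finset.prod_congr rfl fun i _ => by ring

theorem qPochInf_mul_neg (a : ℂ) {q : ℂ} (hq : ‖q‖ < 1) :
    qPochInf a q * qPochInf (-a) q = qPochInf (a ^ 2) (q ^ 2) := by
  have h := (tendsto_qPoch a hq).mul (tendsto_qPoch (-a) hq)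
  refine tendsto_nhds_unique h ?_
  simp only [qPoch_mul_qPoch_neg]
  exact tendsto_qPoch (a ^ 2) (norm_pow_lt_one hq two_ne_zero)

theorem one_sub_ne_zero_of_norm_lt_one {a : ℂ} (ha : ‖a‖ < 1) : 1 - a ≠ 0 := by
  intro h
  rw [← sub_eq_zero.mp h] at ha
  simp at ha

theorem one_sub_mul_pow_ne_zero {a q : ℂ} (hq : ‖q‖ < 1) (ha : ‖a‖ < 1) (k : ℕ) :
    1 - a * q ^ k ≠ 0 := by
  apply one_sub_ne_zero_of_norm_lt_one
  rw [norm_mul, norm_pow]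
  exact (mul_le_of_le_one_right (norm_nonneg _) (pow_le_one₀ (norm_nonneg _) hq.le)).trans_lt ha

theorem tendsto_inv_qPoch {a q : ℂ} (hq : ‖q‖ < 1) (h : ∀ k : ℕ, 1 - a * q ^ k ≠ 0) :
    Tendsto (fun n => (qPoch a q n)⁻¹) atTop (𝓝 (qPochInf a q)⁻¹) :=
  (tendsto_qPoch a hq).inv₀ (qPochInf_ne_zero hq h)

theorem exists_norm_inv_qPoch_le {a q : ℂ} (hq : ‖q‖ < 1) (h : ∀ k : ℕ, 1 - a * q ^ k ≠ 0) :
    ∃ C : ℝ, 0 ≤ C ∧ ∀ n, ‖(qPoch a q n)⁻¹‖ ≤ C := by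
  obtain ⟨C, hC⟩ := (Metric.isBounded_range_of_tendsto _ (tendsto_inv_qPoch hq h)).exists_norm_le
  exact ⟨C, (norm_nonneg _).trans (hC _ ⟨0, rfl⟩), fun n => hC _ ⟨n, rfl⟩⟩

/-! ### Absolute convergence and Euler's expansion. -/

/-- Ratio test: consecutive terms have ratio $wq^{2n+1}\to0$. The series over naturals below are
dominated by this one, their reciprocal factorials being bounded. -/
theorem summable_norm_pow_mul_pow_sq (w : ℂ) {q : ℂ} (hq : ‖q‖ < 1) :
    Summable fun n : ℕ => ‖w ^ n * q ^ n ^ 2‖ := by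
  refine summable_of_ratio_norm_eventually_le (r := 1 / 2) (by norm_num) ?_
  have h : Tendsto (fun n : ℕ => ‖w‖ * (‖q‖ * ‖q‖ ^ n)) atTop (𝓝 0) := by
    simpa using ((tendsto_pow_atTop_nhds_zero_of_lt_one (norm_nonneg q) hq).const_mul
      ‖q‖).const_mul ‖w‖
  filter_upwards [h.eventually_le_const (show (0 : ℝ) < 1 / 2 by norm_num)] with n hn
  have e : w ^ (n + 1) * q ^ (n + 1) ^ 2 = w * (q * q ^ n) * q ^ n * (w ^ n * q ^ n ^ 2) := by ring
  rw [norm_norm, norm_norm, e, norm_mul, norm_mul, norm_mul, norm_mul, norm_pow]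
  gcongr
  exact (mul_le_of_le_one_right (by positivity) (pow_le_one₀ (norm_nonneg _) hq.le)).trans hn

theorem summable_norm_mul_of_bounded {f g : ℕ → ℂ} {C : ℝ} (hf : Summable fun n => ‖f n‖)
    (hg : ∀ n, ‖g n‖ ≤ C) : Summable fun n => ‖f n * g n‖ := by
  refine Summable.of_nonneg_of_le (fun _ => norm_nonneg _) (fun n => ?_) (hf.mul_right C)
  rw [norm_mul]
  exact mul_le_mul_of_nonneg_left (hg n) (norm_nonneg _)

theorem summable_norm_pow_mul_pow_sq_mul {w q : ℂ} (hq : ‖q‖ < 1) {g : ℕ → ℂ} {C : ℝ}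
    (hg : ∀ n, ‖g n‖ ≤ C) : Summable fun n : ℕ => ‖w ^ n * q ^ n ^ 2 * g n‖ :=
  summable_norm_mul_of_bounded (summable_norm_pow_mul_pow_sq w hq) hg

/-- Euler's expansion of an infinite `q`-shifted factorial. -/
theorem qPochInf_eq_tsum (y : ℂ) {q : ℂ} (hq : ‖q‖ < 1) :
    qPochInf (y * q) (q ^ 2) =
      ∑' m : ℕ, (-y) ^ m * q ^ m ^ 2 * (qPoch (q ^ 2) (q ^ 2) m)⁻¹ := by
  have hq2 := norm_pow_lt_one hq two_ne_zero
  have hne := one_sub_mul_pow_ne_zero hq2 hq2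
  obtain ⟨C, hC0, hC⟩ := exists_norm_inv_qPoch_le hq2 hne
  set E : ℂ → ℂ := fun y => ∑' m : ℕ, (-y) ^ m * q ^ m ^ 2 * (qPoch (q ^ 2) (q ^ 2) m)⁻¹ with hE
  have hs : ∀ y : ℂ, Summable fun m : ℕ => (-y) ^ m * q ^ m ^ 2 * (qPoch (q ^ 2) (q ^ 2) m)⁻¹ :=
    fun y => (summable_norm_pow_mul_pow_sq_mul hq hC).of_norm
  -- In $E(y)-E(yq^2)$ the factor $1-q^{2m}$ cancels the last factor of $(q^2;q^2)_m$, which shifts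
  -- the index by one. Iterating drives the argument to 0, where $E=1$.
  have hrec : ∀ y, E y = (1 - y * q) * E (y * q ^ 2) := by
    intro y
    have h1 : E y - E (y * q ^ 2) = -(y * q) * E (y * q ^ 2) := by
      simp only [hE]
      rw [← (hs y).tsum_sub (hs _), ((hs y).sub (hs _)).tsum_eq_zero_add, ← tsum_mul_left]
      simp only [pow_zero, one_mul, sub_self, zero_add]
      refine tsum_congr fun m => ?_
      rw [qPoch_succ]
      have := qPoch_ne_zero hne m
      have := hne m
      field_simp
      ring
    linear_combination h1
  have hiter : ∀ n : ℕ, E y = qPoch (y * q) (q ^ 2) n * E (y * (q ^ 2) ^ n) := by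
    intro n
    induction n with
    | zero => simp [qPoch]
    | succ n ih => rw [ih, hrec, qPoch_succ]; ring_nf
  have hE0 : E 0 = 1 := by
    simp only [hE]
    rw [tsum_eq_single 0 (fun m hm => by simp [hm])]
    simp [qPoch]
  have hlim : Tendsto (fun n : ℕ => E (y * (q ^ 2) ^ n)) atTop (𝓝 1) := by
    rw [← hE0]
    refine tendsto_tsum_of_dominated_convergence
      (summable_norm_pow_mul_pow_sq_mul (w := y) hq hC) (fun m => ?_) (Eventually.of_forall ?_)
    · have h0 : Tendsto (fun n : ℕ => y * (q ^ 2) ^ n) atTop (𝓝 0) := by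
        simpa using (tendsto_pow_atTop_nhds_zero_of_norm_lt_one hq2).const_mul y
      exact ((h0.neg.pow m).mul_const _).mul_const _
    · intro n m
      simp only [norm_mul, norm_pow, norm_neg]
      gcongr
      exact mul_le_of_le_one_right (norm_nonneg _) (pow_le_one₀ (by positivity)
        (by simpa using hq2.le))
  have hl := (tendsto_qPoch (y * q) hq2).mul hlim
  simp only [← hiter, mul_one] at hl
  exact tendsto_nhds_unique hl tendsto_const_nhds

/-! ### Rearranging double sums whose coupling factor is bounded by 1. -/

section DoubleSum

variable {u v : ℕ → ℂ} {c : ℕ → ℕ → ℂ}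

theorem summable_mul_mul_of_norm_le_one (hu : Summable fun n => ‖u n‖)
    (hv : Summable fun n => ‖v n‖) (hc : ∀ n m, ‖c n m‖ ≤ 1) :
    Summable fun x : ℕ × ℕ => u x.1 * v x.2 * c x.1 x.2 := by
  refine Summable.of_norm_bounded (g := fun x : ℕ × ℕ => ‖u x.1‖ * ‖v x.2‖)
    (Summable.mul_of_nonneg hu hv (fun _ => norm_nonneg _) fun _ => norm_nonneg _) fun x => ?_
  rw [norm_mul, norm_mul]
  exact mul_le_of_le_one_right (by positivity) (hc _ _)

theorem tsum_tsum_comm_of_norm_le_one (hu : Summable fun n => ‖u n‖)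
    (hv : Summable fun n => ‖v n‖) (hc : ∀ n m, ‖c n m‖ ≤ 1) :
    ∑' n, u n * ∑' m, v m * c n m = ∑' m, v m * ∑' n, u n * c n m := by
  have h := summable_mul_mul_of_norm_le_one hu hv hc
  have := Summable.tsum_comm (f := fun n m => u n * v m * c n m) h
  simp only [← tsum_mul_left]
  calc ∑' n, ∑' m, u n * (v m * c n m) = ∑' n, ∑' m, u n * v m * c n m := by
        simp only [mul_assoc]
    _ = ∑' m, ∑' n, u n * v m * c n m := this.symm
    _ = _ := tsum_congr fun m => tsum_congr fun n => by ring

theorem tsum_tsum_eq_tsum_sum_antidiagonal (hu : Summable fun n => ‖u n‖)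
    (hv : Summable fun n => ‖v n‖) (hc : ∀ n m, ‖c n m‖ ≤ 1) :
    ∑' n, u n * ∑' m, v m * c n m =
      ∑' N, ∑ x ∈ Finset.HasAntidiagonal.antidiagonal N, u x.1 * v x.2 * c x.1 x.2 := by
  have h := summable_mul_mul_of_norm_le_one hu hv hc
  have h1 := h.tsum_prod
  have h2 := Finset.HasAntidiagonal.sigmaAntidiagonalEquivProd.tsum_eq
    (fun x : ℕ × ℕ => u x.1 * v x.2 * c x.1 x.2)
  have h3 := (Finset.HasAntidiagonal.sigmaAntidiagonalEquivProd.summable_iff.mpr h).tsum_sigma'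
    (fun n => (hasSum_fintype _).summable)
  simp only [← tsum_mul_left, ← mul_assoc]
  rw [← h1, ← h2]
  refine h3.trans (tsum_congr fun N => ?_)
  exact (tsum_fintype _).trans (Finset.sum_coe_sort _ fun x : ℕ × ℕ => u x.1 * v x.2 * c x.1 x.2)

end DoubleSum

/-! ### Finite convolutions through formal power series. -/

theorem inv_qPoch_succ_mul {q : ℂ} (hq : ‖q‖ < 1) (n : ℕ) :
    (qPoch q q (n + 1))⁻¹ * (1 - q ^ (n + 1)) = (qPoch q q n)⁻¹ := by
  have h := one_sub_mul_pow_ne_zero hq hq n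
  rw [qPoch_succ, mul_inv, pow_succ', mul_assoc, inv_mul_cancel₀ h, mul_one]

/-- The generating series `∑ xⁿ / (q;q)_n`. -/
noncomputable def invQPochSeries (q : ℂ) : PowerSeries ℂ :=
  PowerSeries.mk fun n => (qPoch q q n)⁻¹

theorem rescale_invQPochSeries {q : ℂ} (hq : ‖q‖ < 1) :
    PowerSeries.rescale q (invQPochSeries q) = (1 - PowerSeries.X) * invQPochSeries q := by
  ext n
  rw [sub_mul, one_mul, map_sub]
  cases n with
  | zero => simp [invQPochSeries, PowerSeries.coeff_rescale]
  | succ n =>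
    rw [PowerSeries.coeff_succ_X_mul, PowerSeries.coeff_rescale]
    simp only [invQPochSeries, PowerSeries.coeff_mk]
    linear_combination -inv_qPoch_succ_mul hq n

/-- The equation $f(qx)=(1-x)f(x)$ reads $(1-q^{n+1})f_{n+1}=f_n$ on coefficients, so it determines
$f$ from $f_0$. Both convolutions below follow by checking it for a product of series. -/
theorem coeff_eq_inv_qPoch {q : ℂ} (hq : ‖q‖ < 1) {f : PowerSeries ℂ}
    (h0 : PowerSeries.coeff 0 f = 1)
    (hf : PowerSeries.rescale q f = (1 - PowerSeries.X) * f) (n : ℕ) :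
    PowerSeries.coeff n f = (qPoch q q n)⁻¹ := by
  induction n with
  | zero => rw [h0, qPoch_zero, inv_one]
  | succ n ih =>
    have h := congrArg (PowerSeries.coeff (n + 1)) hf
    rw [sub_mul, one_mul, map_sub, PowerSeries.coeff_succ_X_mul, PowerSeries.coeff_rescale, ih] at h
    have h1 := one_sub_ne_zero_of_norm_lt_one (norm_pow_lt_one hq (Nat.add_one_ne_zero n))
    apply mul_right_cancel₀ h1
    rw [inv_qPoch_succ_mul hq]
    linear_combination -h

/-- Coefficient form of $1/((x;q^2)_\infty(xq;q^2)_\infty)=1/(x;q)_\infty$. -/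
theorem sum_antidiagonal_pow_mul_inv_qPoch_sq {q : ℂ} (hq : ‖q‖ < 1) (N : ℕ) :
    ∑ x ∈ Finset.HasAntidiagonal.antidiagonal N,
      (qPoch (q ^ 2) (q ^ 2) x.1)⁻¹ * (q ^ x.2 * (qPoch (q ^ 2) (q ^ 2) x.2)⁻¹) =
        (qPoch q q N)⁻¹ := by
  set B := invQPochSeries (q ^ 2) with hB
  have h2 := rescale_invQPochSeries (norm_pow_lt_one hq two_ne_zero)
  have h := coeff_eq_inv_qPoch hq (f := B * PowerSeries.rescale q B) ?_ ?_ N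
  · rw [← h, PowerSeries.coeff_mul]
    simp [hB, invQPochSeries, PowerSeries.coeff_rescale]
  · simp [hB, invQPochSeries, PowerSeries.coeff_mul, PowerSeries.coeff_rescale, qPoch_zero]
  · rw [map_mul, PowerSeries.rescale_rescale, ← pow_two, h2]
    ring

/-- Coefficient form of $(xq;q^2)_\infty/(x;q)_\infty=1/(x;q^2)_\infty$. -/
theorem sum_antidiagonal_neg_one_pow_mul_inv_qPoch {q : ℂ} (hq : ‖q‖ < 1) (N : ℕ) :
    ∑ x ∈ Finset.HasAntidiagonal.antidiagonal N,
      (-1) ^ x.1 * q ^ x.1 ^ 2 * (qPoch (q ^ 2) (q ^ 2) x.1)⁻¹ * (qPoch q q x.2)⁻¹ =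
        (qPoch (q ^ 2) (q ^ 2) N)⁻¹ := by
  have hq2 := norm_pow_lt_one hq two_ne_zero
  set B := invQPochSeries q with hB
  set A : PowerSeries ℂ :=
    PowerSeries.mk fun n => (-1) ^ n * q ^ n ^ 2 * (qPoch (q ^ 2) (q ^ 2) n)⁻¹ with hA
  have hAr : A = (1 - PowerSeries.C q * PowerSeries.X) * PowerSeries.rescale (q ^ 2) A := by
    ext n
    rw [sub_mul, one_mul, map_sub, mul_assoc, PowerSeries.coeff_C_mul]
    cases n with
    | zero => simp [PowerSeries.coeff_rescale]
    | succ n =>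
      rw [PowerSeries.coeff_succ_X_mul, PowerSeries.coeff_rescale, PowerSeries.coeff_rescale]
      simp only [hA, PowerSeries.coeff_mk]
      rw [← inv_qPoch_succ_mul hq2 n]
      ring
  have hBr : PowerSeries.rescale (q ^ 2) B =
      (1 - PowerSeries.C q * PowerSeries.X) * ((1 - PowerSeries.X) * B) := by
    rw [pow_two, ← PowerSeries.rescale_rescale, rescale_invQPochSeries hq, map_mul,
      rescale_invQPochSeries hq, map_sub, map_one, PowerSeries.rescale_X]
  have h := coeff_eq_inv_qPoch hq2 (f := A * B) ?_ ?_ N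
  · rw [← h, PowerSeries.coeff_mul]
    simp [hB, hA, invQPochSeries]
  · simp [hB, hA, invQPochSeries, PowerSeries.coeff_mul, qPoch_zero]
  · rw [map_mul, hBr]
    conv_rhs => rw [hAr]
    ring

/-! ### The two transformations, and Rogers' series as a Rogers–Ramanujan series. -/

section Transformation

variable {q z : ℂ}

theorem qPochInf_mul_tsum_pow_three_mul_sq (hq : ‖q‖ < 1)
    (hz : ∀ k : ℕ, 1 - z * q * (q ^ 2) ^ k ≠ 0) :
    qPochInf (z * q) (q ^ 2) * ∑' n : ℕ,
        z ^ n * q ^ (3 * n ^ 2) / (qPoch (z * q) (q ^ 2) n * qPoch (q ^ 4) (q ^ 4) n) =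
      ∑' n : ℕ, (-z) ^ n * q ^ (n ^ 2) / qPoch (q ^ 4) (q ^ 4) n := by
  have hq2 := norm_pow_lt_one hq two_ne_zero
  have hq3 := norm_pow_lt_one hq three_ne_zero
  have hq4 := norm_pow_lt_one hq four_ne_zero
  obtain ⟨C, -, hC⟩ := exists_norm_inv_qPoch_le hq2 (one_sub_mul_pow_ne_zero hq2 hq2)
  obtain ⟨D, -, hD⟩ := exists_norm_inv_qPoch_le hq4 (one_sub_mul_pow_ne_zero hq4 hq4)
  have h := tsum_tsum_eq_tsum_sum_antidiagonal (c := fun n m => q ^ (2 * n * m))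
    (summable_norm_pow_mul_pow_sq_mul (w := z) hq3 hD)
    (summable_norm_pow_mul_pow_sq_mul (w := -z) hq hC)
    (fun n m => by rw [norm_pow]; exact pow_le_one₀ (norm_nonneg _) hq.le)
  rw [← tsum_mul_left]
  refine Eq.trans (tsum_congr fun n => ?_) (h.trans (tsum_congr fun N => ?_))
  · have e : ∑' m : ℕ, (-z) ^ m * q ^ m ^ 2 * (qPoch (q ^ 2) (q ^ 2) m)⁻¹ * q ^ (2 * n * m) =
        qPochInf (z * q * (q ^ 2) ^ n) (q ^ 2) := by
      rw [show z * q * (q ^ 2) ^ n = z * (q ^ 2) ^ n * q by ring, qPochInf_eq_tsum _ hq]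
      exact tsum_congr fun m => by ring
    rw [e, qPochInf_eq_mul _ hq2 n]
    have := qPoch_ne_zero hz n
    field_simp
    ring_nf
  -- The convolution is used with base $q^2$; its sign $(-1)^n$ turns $z^n(-z)^m$ into $(-z)^N$.
  · rw [show (-z) ^ N * q ^ N ^ 2 / qPoch (q ^ 4) (q ^ 4) N =
      (-z) ^ N * q ^ N ^ 2 * (qPoch ((q ^ 2) ^ 2) ((q ^ 2) ^ 2) N)⁻¹ by ring_nf,
      ← sum_antidiagonal_neg_one_pow_mul_inv_qPoch hq2, Finset.mul_sum]
    refine Finset.sum_congr rfl fun x hx => ?_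
    rw [← Finset.HasAntidiagonal.mem_antidiagonal.mp hx, show (q ^ 2) ^ 2 = q ^ 4 by ring, pow_add, neg_pow z x.1]
    have : ((-1 : ℂ) ^ x.1) * (-1) ^ x.1 = 1 := by rw [← mul_pow]; simp
    linear_combination -(z ^ x.1 * (-z) ^ x.2 * q ^ (x.1 + x.2) ^ 2 * (q ^ 2) ^ x.1 ^ 2 *
      (qPoch (q ^ 4) (q ^ 4) x.1)⁻¹ * (qPoch (q ^ 2) (q ^ 2) x.2)⁻¹) * this

theorem tsum_pow_sq_add_self_mul (hq : ‖q‖ < 1) (m : ℕ) :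
    ∑' n : ℕ, q ^ n * q ^ n ^ 2 * (qPoch (q ^ 2) (q ^ 2) n)⁻¹ * q ^ (2 * n * m) =
      qPochInf (-q ^ 2) (q ^ 2) * (qPoch (-q ^ 2) (q ^ 2) m)⁻¹ := by
  have hq2 := norm_pow_lt_one hq two_ne_zero
  have hne := qPoch_ne_zero (one_sub_mul_pow_ne_zero (a := -q ^ 2) hq2 (by simpa using hq2)) m
  rw [qPochInf_eq_mul _ hq2 m, mul_right_comm, mul_inv_cancel₀ hne, one_mul,
    show -q ^ 2 * (q ^ 2) ^ m = -q ^ (2 * m + 1) * q by ring, qPochInf_eq_tsum _ hq]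
  exact tsum_congr fun n => by rw [neg_neg]; ring

theorem inv_qPoch_four (q : ℂ) (n : ℕ) : (qPoch (q ^ 4) (q ^ 4) n)⁻¹ =
    (qPoch (q ^ 2) (q ^ 2) n)⁻¹ * (qPoch (-q ^ 2) (q ^ 2) n)⁻¹ := by
  rw [← mul_inv, qPoch_mul_qPoch_neg]
  ring_nf

theorem qPochInf_mul_tsum_pow_sq_add_self (hq : ‖q‖ < 1)
    (hz : ∀ k : ℕ, 1 - z * q * (q ^ 2) ^ k ≠ 0) :
    qPochInf (z * q) (q ^ 2) * ∑' n : ℕ,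
        q ^ (n ^ 2 + n) / (qPoch (z * q) (q ^ 2) n * qPoch (q ^ 2) (q ^ 2) n) =
      qPochInf (-q ^ 2) (q ^ 2) *
        ∑' n : ℕ, (-z) ^ n * q ^ (n ^ 2) / qPoch (q ^ 4) (q ^ 4) n := by
  have hq2 := norm_pow_lt_one hq two_ne_zero
  obtain ⟨C, -, hC⟩ := exists_norm_inv_qPoch_le hq2 (one_sub_mul_pow_ne_zero hq2 hq2)
  have h := tsum_tsum_comm_of_norm_le_one (c := fun n m => q ^ (2 * n * m))
    (summable_norm_pow_mul_pow_sq_mul (w := q) hq hC)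
    (summable_norm_pow_mul_pow_sq_mul (w := -z) hq hC)
    (fun n m => by rw [norm_pow]; exact pow_le_one₀ (norm_nonneg _) hq.le)
  rw [← tsum_mul_left, ← tsum_mul_left]
  refine Eq.trans (tsum_congr fun n => ?_) (h.trans (tsum_congr fun m => ?_))
  · have e : ∑' m : ℕ, (-z) ^ m * q ^ m ^ 2 * (qPoch (q ^ 2) (q ^ 2) m)⁻¹ * q ^ (2 * n * m) =
        qPochInf (z * q * (q ^ 2) ^ n) (q ^ 2) := by
      rw [show z * q * (q ^ 2) ^ n = z * (q ^ 2) ^ n * q by ring, qPochInf_eq_tsum _ hq]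
      exact tsum_congr fun m => by ring
    rw [e, qPochInf_eq_mul _ hq2 n]
    have := qPoch_ne_zero hz n
    field_simp
    ring_nf
  · rw [tsum_pow_sq_add_self_mul hq, div_eq_mul_inv, inv_qPoch_four]
    ring

theorem qPochInf_mul_tsum_pow_sq_div (hq : ‖q‖ < 1) :
    qPochInf (-q ^ 2) (q ^ 2) * ∑' n : ℕ, q ^ (n ^ 2) / qPoch (q ^ 4) (q ^ 4) n =
      ∑' n : ℕ, q ^ n ^ 2 * (qPoch q q n)⁻¹ := by
  have hq2 := norm_pow_lt_one hq two_ne_zero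
  obtain ⟨C, -, hC⟩ := exists_norm_inv_qPoch_le hq2 (one_sub_mul_pow_ne_zero hq2 hq2)
  have h := tsum_tsum_eq_tsum_sum_antidiagonal (c := fun n m => q ^ (2 * m * n))
    (summable_norm_pow_mul_pow_sq_mul (w := 1) hq hC)
    (summable_norm_pow_mul_pow_sq_mul (w := q) hq hC)
    (fun n m => by rw [norm_pow]; exact pow_le_one₀ (norm_nonneg _) hq.le)
  rw [← tsum_mul_left]
  refine Eq.trans (tsum_congr fun n => ?_) (h.trans (tsum_congr fun N => ?_))
  · rw [tsum_pow_sq_add_self_mul hq, div_eq_mul_inv, inv_qPoch_four]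
    ring
  -- The exponent is $n^2+2nm+m^2+m=N^2+m$.
  · rw [← sum_antidiagonal_pow_mul_inv_qPoch_sq hq, Finset.mul_sum]
    refine Finset.sum_congr rfl fun x hx => ?_
    rw [← Finset.HasAntidiagonal.mem_antidiagonal.mp hx]
    ring

end Transformation

/-! ### Reciprocal factorials indexed by integers. -/

/-- The reciprocal `1 / (q;q)_k` for integral `k`, with value `0` for negative `k`. -/
noncomputable def invQPochInt (q : ℂ) (k : ℤ) : ℂ :=
  if k < 0 then 0 else (qPoch q q k.toNat)⁻¹

theorem invQPochInt_of_neg (q : ℂ) {k : ℤ} (hk : k < 0) : invQPochInt q k = 0 := if_pos hk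

theorem invQPochInt_natCast (q : ℂ) (n : ℕ) : invQPochInt q n = (qPoch q q n)⁻¹ := by
  simp [invQPochInt]

theorem invQPochInt_zero (q : ℂ) : invQPochInt q 0 = 1 := by simp [invQPochInt, qPoch]

/-- The value 0 at negative indices makes the recurrence hold for every integer (at $k=0$ both sides
vanish), so bilateral sums can be shifted without boundary terms. -/
theorem one_sub_zpow_mul_invQPochInt {q : ℂ} (hq : ‖q‖ < 1) (k : ℤ) :
    (1 - q ^ k) * invQPochInt q k = invQPochInt q (k - 1) := by
  rcases lt_trichotomy k 0 with hk | rfl | hk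
  · rw [invQPochInt_of_neg q hk, invQPochInt_of_neg q (by lia), mul_zero]
  · rw [invQPochInt_of_neg q (show (0 : ℤ) - 1 < 0 by lia)]; simp
  · obtain ⟨n, rfl⟩ : ∃ n : ℕ, k = (n + 1 : ℕ) := ⟨(k - 1).toNat, by lia⟩
    rw [invQPochInt_natCast, show ((n + 1 : ℕ) : ℤ) - 1 = n by lia, invQPochInt_natCast,
      zpow_natCast, mul_comm, inv_qPoch_succ_mul hq]

theorem exists_norm_invQPochInt_le {q : ℂ} (hq : ‖q‖ < 1) :
    ∃ C : ℝ, 0 ≤ C ∧ ∀ k, ‖invQPochInt q k‖ ≤ C := by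
  obtain ⟨C, hC0, hC⟩ := exists_norm_inv_qPoch_le hq (one_sub_mul_pow_ne_zero hq hq)
  refine ⟨C, hC0, fun k => ?_⟩
  unfold invQPochInt
  split_ifs
  · simpa using hC0
  · exact hC _

theorem tendsto_int_toNat_atTop : Tendsto Int.toNat atTop atTop := by
  refine tendsto_atTop.mpr fun b => ?_
  filter_upwards [eventually_ge_atTop (b : ℤ)] with k hk
  lia

theorem tendsto_invQPochInt {q : ℂ} (hq : ‖q‖ < 1) :
    Tendsto (invQPochInt q) atTop (𝓝 (qPochInf q q)⁻¹) := by
  refine ((tendsto_inv_qPoch hq (one_sub_mul_pow_ne_zero hq hq)).comp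
    tendsto_int_toNat_atTop).congr' ?_
  filter_upwards [eventually_ge_atTop 0] with k hk
  simp [invQPochInt, hk]

theorem tendsto_invQPochInt_add {q : ℂ} (hq : ‖q‖ < 1) (r : ℤ) :
    Tendsto (fun n : ℕ => invQPochInt q (n + r)) atTop (𝓝 (qPochInf q q)⁻¹) :=
  (tendsto_invQPochInt hq).comp
    (tendsto_atTop_add_const_right _ r tendsto_natCast_atTop_atTop)

theorem tendsto_invQPochInt_sub {q : ℂ} (hq : ‖q‖ < 1) (r : ℤ) :
    Tendsto (fun n : ℕ => invQPochInt q (n - r)) atTop (𝓝 (qPochInf q q)⁻¹) := by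
  simpa only [sub_eq_add_neg] using tendsto_invQPochInt_add hq (-r)

theorem summable_of_eq_zero_off_Icc {f : ℤ → ℂ} (a b : ℤ) (h : ∀ r, r < a ∨ b < r → f r = 0) :
    Summable f := by
  refine summable_of_ne_finset_zero (s := Finset.Icc a b) fun r hr => h r ?_
  rw [Finset.mem_Icc] at hr
  lia

theorem tsum_int_shift (f : ℤ → ℂ) (a : ℤ) : ∑' r, f (r + a) = ∑' r, f r :=
  (Equiv.addRight a).tsum_eq f

/-! ### The Jacobi triple product from its finite form. -/

section FiniteJacobi

variable {p x : ℂ}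

/-- With $A=p^{2(m+1-r)}$ and $B=p^{2(n+r)}$, the prefactor is $1-AB=(1-A)+A(1-B)$. Each bracket
lowers one index, and shifting $r$ by one makes the second sum a multiple of the first. The base is
$p^2$ so that $p^{r^2-r}$ plays the role of $q^{r(r-1)/2}$. -/
theorem finiteJacobi_left (hp : ‖p‖ < 1) (hp0 : p ≠ 0) (hx : x ≠ 0) (m n : ℤ) :
    (1 - (p ^ 2) ^ (m + 1 + n)) * ∑' r : ℤ, (-x) ^ r * p ^ (r * r - r) *
        (invQPochInt (p ^ 2) (m + 1 - r) * invQPochInt (p ^ 2) (n + r)) =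
      (1 - x * (p ^ 2) ^ m) * ∑' r : ℤ, (-x) ^ r * p ^ (r * r - r) *
        (invQPochInt (p ^ 2) (m - r) * invQPochInt (p ^ 2) (n + r)) := by
  have hq := norm_pow_lt_one hp two_ne_zero
  have hq0 : p ^ 2 ≠ 0 := pow_ne_zero 2 hp0
  set R := invQPochInt (p ^ 2) with hR
  set t : ℤ → ℂ := fun r => (-x) ^ r * p ^ (r * r - r) * (R (m - r) * R (n + r)) with ht
  set g : ℤ → ℂ := fun r => (-x) ^ r * p ^ (r * r - r) *
    ((p ^ 2) ^ (m + 1 - r) * (R (m + 1 - r) * R (n + r - 1))) with hg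
  have hts : Summable t := summable_of_eq_zero_off_Icc (-n) m fun r hr => by
    rcases hr with hr | hr
    · simp [ht, hR, invQPochInt_of_neg (p ^ 2) (show n + r < 0 by lia)]
    · simp [ht, hR, invQPochInt_of_neg (p ^ 2) (show m - r < 0 by lia)]
  have hgs : Summable g := summable_of_eq_zero_off_Icc (1 - n) (m + 1) fun r hr => by
    rcases hr with hr | hr
    · simp [hg, hR, invQPochInt_of_neg (p ^ 2) (show n + r - 1 < 0 by lia)]
    · simp [hg, hR, invQPochInt_of_neg (p ^ 2) (show m + 1 - r < 0 by lia)]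
  have hshift : ∀ r, g (r + 1) = -(x * (p ^ 2) ^ m) * t r := by
    intro r
    simp only [hg, ht]
    rw [show m + 1 - (r + 1) = m - r by ring, show n + (r + 1) - 1 = n + r by ring,
      zpow_add_one₀ (neg_ne_zero.mpr hx)]
    have e : p ^ ((r + 1) * (r + 1) - (r + 1)) * (p ^ 2) ^ (m - r) =
        (p ^ 2) ^ m * p ^ (r * r - r) := by
      simp only [← zpow_natCast, ← zpow_mul, ← zpow_add₀ hp0]
      congr 1; push_cast; ring
    linear_combination (-x) ^ r * (-x) * R (m - r) * R (n + r) * e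
  have hsum : (1 - x * (p ^ 2) ^ m) * tsum t = ∑' r, (t r + g r) := by
    rw [hts.tsum_add hgs, ← tsum_int_shift g 1, tsum_congr hshift, tsum_mul_left]
    ring
  rw [hsum, ← tsum_mul_left]
  refine tsum_congr fun r => ?_
  have h1 := one_sub_zpow_mul_invQPochInt hq (m + 1 - r)
  have h2 := one_sub_zpow_mul_invQPochInt hq (n + r)
  rw [show m + 1 - r - 1 = m - r by ring] at h1
  have e : (p ^ 2) ^ (m + 1 + n) = (p ^ 2) ^ (m + 1 - r) * (p ^ 2) ^ (n + r) := by
    rw [← zpow_add₀ hq0]; congr 1; ring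
  rw [← hR] at h1 h2
  simp only [hg, ht]
  rw [e, ← h1, ← h2]
  ring

theorem finiteJacobi_right (hp : ‖p‖ < 1) (hp0 : p ≠ 0) (hx : x ≠ 0) (m n : ℤ) :
    (1 - (p ^ 2) ^ (m + (n + 1))) * ∑' r : ℤ, (-x) ^ r * p ^ (r * r - r) *
        (invQPochInt (p ^ 2) (m - r) * invQPochInt (p ^ 2) (n + 1 + r)) =
      (1 - p ^ 2 / x * (p ^ 2) ^ n) * ∑' r : ℤ, (-x) ^ r * p ^ (r * r - r) *
        (invQPochInt (p ^ 2) (m - r) * invQPochInt (p ^ 2) (n + r)) := by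
  have hq := norm_pow_lt_one hp two_ne_zero
  have hq0 : p ^ 2 ≠ 0 := pow_ne_zero 2 hp0
  set R := invQPochInt (p ^ 2) with hR
  set t : ℤ → ℂ := fun r => (-x) ^ r * p ^ (r * r - r) * (R (m - r) * R (n + r)) with ht
  set g : ℤ → ℂ := fun r => (-x) ^ r * p ^ (r * r - r) *
    ((p ^ 2) ^ (n + 1 + r) * (R (m - r - 1) * R (n + 1 + r))) with hg
  have hts : Summable t := summable_of_eq_zero_off_Icc (-n) m fun r hr => by
    rcases hr with hr | hr
    · simp [ht, hR, invQPochInt_of_neg (p ^ 2) (show n + r < 0 by lia)]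
    · simp [ht, hR, invQPochInt_of_neg (p ^ 2) (show m - r < 0 by lia)]
  have hgs : Summable g := summable_of_eq_zero_off_Icc (-n - 1) m fun r hr => by
    rcases hr with hr | hr
    · simp [hg, hR, invQPochInt_of_neg (p ^ 2) (show n + 1 + r < 0 by lia)]
    · simp [hg, hR, invQPochInt_of_neg (p ^ 2) (show m - r - 1 < 0 by lia)]
  have hshift : ∀ r, g (r + -1) = -(p ^ 2 / x * (p ^ 2) ^ n) * t r := by
    intro r
    simp only [hg, ht]
    rw [show m - (r + -1) - 1 = m - r by ring, show n + 1 + (r + -1) = n + r by ring,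
      zpow_add₀ (neg_ne_zero.mpr hx)]
    have e : p ^ ((r + -1) * (r + -1) - (r + -1)) * (p ^ 2) ^ (n + r) =
        p ^ 2 * (p ^ 2) ^ n * p ^ (r * r - r) := by
      simp only [← zpow_natCast, ← zpow_mul, ← zpow_add₀ hp0]
      congr 1; push_cast; ring
    have e2 : (-x) ^ (-1 : ℤ) = -(1 / x) := by rw [zpow_neg_one]; field_simp
    rw [e2]
    linear_combination (-x) ^ r * (-(1 / x)) * R (m - r) * R (n + r) * e
  have hsum : (1 - p ^ 2 / x * (p ^ 2) ^ n) * tsum t = ∑' r, (t r + g r) := by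
    rw [hts.tsum_add hgs, ← tsum_int_shift g (-1), tsum_congr hshift, tsum_mul_left]
    ring
  rw [hsum, ← tsum_mul_left]
  refine tsum_congr fun r => ?_
  have h1 := one_sub_zpow_mul_invQPochInt hq (m - r)
  have h2 := one_sub_zpow_mul_invQPochInt hq (n + 1 + r)
  rw [show n + 1 + r - 1 = n + r by ring] at h2
  have e : (p ^ 2) ^ (m + (n + 1)) = (p ^ 2) ^ (m - r) * (p ^ 2) ^ (n + 1 + r) := by
    rw [← zpow_add₀ hq0]; congr 1; ring
  rw [← hR] at h1 h2
  simp only [hg, ht]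
  rw [e, ← h1, ← h2]
  ring

/-- The finite form of the Jacobi triple product. -/
theorem finiteJacobi (hp : ‖p‖ < 1) (hp0 : p ≠ 0) (hx : x ≠ 0) (m n : ℕ) :
    ∑' r : ℤ, (-x) ^ r * p ^ (r * r - r) *
        (invQPochInt (p ^ 2) (m - r) * invQPochInt (p ^ 2) (n + r)) =
      qPoch x (p ^ 2) m * qPoch (p ^ 2 / x) (p ^ 2) n * (qPoch (p ^ 2) (p ^ 2) (m + n))⁻¹ := by
  have hq := norm_pow_lt_one hp two_ne_zero
  have hne : ∀ k : ℕ, 1 - (p ^ 2) ^ (k + 1) ≠ 0 := fun k =>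
    one_sub_ne_zero_of_norm_lt_one (norm_pow_lt_one hq k.succ_ne_zero)
  induction m with
  | zero =>
    induction n with
    | zero =>
      rw [tsum_eq_single 0 fun r hr => ?_]
      · simp [invQPochInt_zero, qPoch]
      · rcases hr.lt_or_gt with h | h
        · simp [invQPochInt_of_neg _ h]
        · simp [invQPochInt_of_neg _ (neg_lt_zero.mpr h)]
    | succ n ih =>
      have h := finiteJacobi_right hp hp0 hx ((0 : ℕ) : ℤ) n
      rw [ih] at h
      apply mul_left_cancel₀ (hne n)
      have h3 := inv_qPoch_succ_mul hq n
      have e : (p ^ 2) ^ (((0 : ℕ) : ℤ) + ((n : ℤ) + 1)) = (p ^ 2) ^ (n + 1) := by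
        rw [show ((0 : ℕ) : ℤ) + ((n : ℤ) + 1) = (n + 1 : ℕ) by push_cast; ring, zpow_natCast]
      rw [e, zpow_natCast] at h
      push_cast at h ⊢
      rw [h, zero_add, zero_add, qPoch_succ (p ^ 2 / x), ← h3]
      ring
  | succ m ih =>
    have h := finiteJacobi_left hp hp0 hx m n
    rw [ih] at h
    apply mul_left_cancel₀ (hne (m + n))
    have h3 := inv_qPoch_succ_mul hq (m + n)
    have e : (p ^ 2) ^ ((m : ℤ) + 1 + n) = (p ^ 2) ^ (m + n + 1) := by
      rw [show (m : ℤ) + 1 + n = (m + n + 1 : ℕ) by push_cast; ring, zpow_natCast]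
    rw [e, zpow_natCast] at h
    push_cast at h ⊢
    rw [h, qPoch_succ x, show m + 1 + n = m + n + 1 by ring, ← h3]
    ring

theorem summable_norm_zpow_mul_zpow_mul_self (hp : ‖p‖ < 1) (hp0 : p ≠ 0) (x : ℂ) :
    Summable fun r : ℤ => ‖(-x) ^ r * p ^ (r * r - r)‖ := by
  refine Summable.of_nat_of_neg
    ((summable_norm_pow_mul_pow_sq (-x / p) hp).congr fun n => ?_)
    ((summable_norm_pow_mul_pow_sq (-p / x) hp).congr fun n => ?_)
  · rw [zpow_sub₀ hp0, show (n : ℤ) * n = ((n ^ 2 : ℕ) : ℤ) by push_cast; ring]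
    simp only [zpow_natCast, div_pow]
    congr 1
    ring
  · rw [zpow_sub₀ hp0, show -(n : ℤ) * -n = ((n ^ 2 : ℕ) : ℤ) by push_cast; ring]
    simp only [zpow_natCast, zpow_neg, div_pow, div_inv_eq_mul]
    congr 1
    rw [show ((-x) ^ n)⁻¹ = (-1) ^ n / x ^ n by
      rw [neg_pow, mul_inv, ← inv_pow, inv_neg_one]; ring, neg_pow p]
    ring

/-- Dominated convergence; it serves both the triple product and the limit of the finite
Rogers–Ramanujan identity. -/
theorem tendsto_tsum_mul_invQPochInt {q : ℂ} (hq : ‖q‖ < 1) {α : ℤ → ℂ}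
    (hα : Summable fun r => ‖α r‖) :
    Tendsto (fun n : ℕ => ∑' r, α r * (invQPochInt q (n - r) * invQPochInt q (n + r))) atTop
      (𝓝 ((∑' r, α r) * ((qPochInf q q)⁻¹ * (qPochInf q q)⁻¹))) := by
  obtain ⟨C, hC0, hC⟩ := exists_norm_invQPochInt_le hq
  rw [← tsum_mul_right]
  refine tendsto_tsum_of_dominated_convergence (hα.mul_right (C * C)) (fun r => ?_)
    (Eventually.of_forall fun n r => ?_)
  · exact ((tendsto_invQPochInt_sub hq r).mul (tendsto_invQPochInt_add hq r)).const_mul _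
  · rw [norm_mul, norm_mul]
    gcongr <;> exact hC _

/-- The Jacobi triple product. -/
theorem jacobiTripleProduct (hp : ‖p‖ < 1) (hp0 : p ≠ 0) (hx : x ≠ 0) :
    ∑' r : ℤ, (-x) ^ r * p ^ (r * r - r) =
      qPochInf x (p ^ 2) * qPochInf (p ^ 2 / x) (p ^ 2) * qPochInf (p ^ 2) (p ^ 2) := by
  have hq := norm_pow_lt_one hp two_ne_zero
  have hne := one_sub_mul_pow_ne_zero hq hq
  have hR := inv_ne_zero (qPochInf_ne_zero hq hne)
  have h1 := tendsto_tsum_mul_invQPochInt hq (summable_norm_zpow_mul_zpow_mul_self hp hp0 x)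
  have h2 : Tendsto (fun n => (qPoch (p ^ 2) (p ^ 2) (n + n))⁻¹) atTop
      (𝓝 (qPochInf (p ^ 2) (p ^ 2))⁻¹) :=
    (tendsto_inv_qPoch hq hne).comp (tendsto_id.atTop_add_atTop tendsto_id)
  have h3 := ((tendsto_qPoch x hq).mul (tendsto_qPoch (p ^ 2 / x) hq)).mul h2
  simp only [finiteJacobi hp hp0 hx] at h1
  have h4 := tendsto_nhds_unique h1 h3
  have h5 := qPochInf_ne_zero hq hne
  field_simp at h4 ⊢
  exact h4

end FiniteJacobi

/-! ### The Bailey chain and the first Rogers–Ramanujan identity. -/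

section Bailey

variable {p : ℂ}

/-- A form of the `q`-Chu–Vandermonde summation. -/
theorem tsum_zpow_mul_invQPochInt (hp : ‖p‖ < 1) (hp0 : p ≠ 0) (M : ℕ) (a : ℤ) :
    ∑' k : ℤ, p ^ (2 * (k * k + a * k)) *
        (invQPochInt (p ^ 2) (M - k) * (invQPochInt (p ^ 2) k * invQPochInt (p ^ 2) (k + a))) =
      invQPochInt (p ^ 2) M * invQPochInt (p ^ 2) (M + a) := by
  have hq := norm_pow_lt_one hp two_ne_zero
  induction M generalizing a with
  | zero =>
    rw [tsum_eq_single 0 fun k hk => ?_]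
    · simp [invQPochInt_zero]
    · rcases hk.lt_or_gt with h | h
      · simp [invQPochInt_of_neg _ h]
      · simp [invQPochInt_of_neg _ (neg_lt_zero.mpr h)]
  | succ M ih =>
    set R := invQPochInt (p ^ 2) with hR
    set t : ℤ → ℤ → ℂ := fun a k =>
      p ^ (2 * (k * k + a * k)) * (R (M - k) * (R k * R (k + a))) with ht
    set g : ℤ → ℂ := fun k => p ^ (2 * (k * k + a * k)) *
      ((p ^ 2) ^ ((M : ℤ) + 1 - k) * (R (M + 1 - k) * (R (k - 1) * R (k + a)))) with hg
    have hts : Summable (t a) := summable_of_eq_zero_off_Icc 0 M fun k hk => by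
      rcases hk with hk | hk
      · simp [ht, hR, invQPochInt_of_neg (p ^ 2) hk]
      · simp [ht, hR, invQPochInt_of_neg (p ^ 2) (show (M : ℤ) - k < 0 by lia)]
    have hgs : Summable g := summable_of_eq_zero_off_Icc 1 (M + 1) fun k hk => by
      rcases hk with hk | hk
      · simp [hg, hR, invQPochInt_of_neg (p ^ 2) (show k - 1 < 0 by lia)]
      · simp [hg, hR, invQPochInt_of_neg (p ^ 2) (show (M : ℤ) + 1 - k < 0 by lia)]
    -- The shift in $k$ raises $a$ by one, hence the induction over all $a$ at once.
    have hshift : ∀ k, g (k + 1) = (p ^ 2) ^ ((M : ℤ) + 1 + a) * t (a + 1) k := by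
      intro k
      simp only [hg, ht]
      rw [show (M : ℤ) + 1 - (k + 1) = M - k by ring, show k + 1 - 1 = k by ring,
        show k + (a + 1) = k + 1 + a by ring]
      have e : p ^ (2 * ((k + 1) * (k + 1) + a * (k + 1))) * (p ^ 2) ^ ((M : ℤ) - k) =
          (p ^ 2) ^ ((M : ℤ) + 1 + a) * p ^ (2 * (k * k + (a + 1) * k)) := by
        simp only [← zpow_natCast p 2, ← zpow_mul, ← zpow_add₀ hp0]
        congr 1; push_cast; ring
      linear_combination R (M - k) * (R k * R (k + 1 + a)) * e
    have hne : 1 - (p ^ 2) ^ ((M : ℤ) + 1) ≠ 0 := by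
      have := one_sub_ne_zero_of_norm_lt_one (norm_pow_lt_one hq M.succ_ne_zero)
      exact_mod_cast this
    have h0 := one_sub_zpow_mul_invQPochInt hq ((M : ℤ) + 1)
    have h1 := one_sub_zpow_mul_invQPochInt hq ((M : ℤ) + 1 + a)
    rw [show (M : ℤ) + 1 - 1 = M by ring] at h0
    rw [show (M : ℤ) + 1 + a - 1 = M + a by ring] at h1
    push_cast
    apply mul_left_cancel₀ hne
    rw [← mul_assoc, h0, ← tsum_mul_left]
    have hsum : ∀ k : ℤ, (1 - (p ^ 2) ^ ((M : ℤ) + 1)) * (p ^ (2 * (k * k + a * k)) *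
        (R (M + 1 - k) * (R k * R (k + a)))) = t a k + g k := by
      intro k
      have h2 := one_sub_zpow_mul_invQPochInt hq ((M : ℤ) + 1 - k)
      have h3 := one_sub_zpow_mul_invQPochInt hq k
      rw [show (M : ℤ) + 1 - k - 1 = M - k by ring] at h2
      have e : (p ^ 2) ^ ((M : ℤ) + 1) = (p ^ 2) ^ ((M : ℤ) + 1 - k) * (p ^ 2) ^ k := by
        rw [← zpow_add₀ (pow_ne_zero 2 hp0)]; congr 1; ring
      rw [← hR] at h2 h3
      simp only [hg, ht]
      rw [e, ← h2, ← h3]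
      ring
    rw [tsum_congr hsum, hts.tsum_add hgs, ← tsum_int_shift g 1, tsum_congr hshift, tsum_mul_left,
      ih a, ih (a + 1), show (M : ℤ) + (a + 1) = M + 1 + a by ring]
    linear_combination -R M * h1

/-- Chu–Vandermonde with $s=k+r$, $M=n-r$, $a=2r$; this is the inner sum of a Bailey step. -/
theorem tsum_zpow_mul_invQPochInt_sub_add (hp : ‖p‖ < 1) (hp0 : p ≠ 0) (n r : ℤ) :
    ∑' s : ℤ, p ^ (2 * (s * s)) * (invQPochInt (p ^ 2) (n - s) *
        (invQPochInt (p ^ 2) (s - r) * invQPochInt (p ^ 2) (s + r))) =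
      p ^ (2 * (r * r)) * (invQPochInt (p ^ 2) (n - r) * invQPochInt (p ^ 2) (n + r)) := by
  rcases lt_or_ge n r with h | h
  · rw [invQPochInt_of_neg _ (show n - r < 0 by lia), zero_mul, mul_zero]
    refine (tsum_congr fun s => ?_).trans tsum_zero
    rcases lt_or_ge s r with h1 | h1
    · simp [invQPochInt_of_neg _ (show s - r < 0 by lia)]
    · simp [invQPochInt_of_neg _ (show n - s < 0 by lia)]
  · obtain ⟨M, hM⟩ := Int.eq_ofNat_of_zero_le (show 0 ≤ n - r by lia)
    obtain rfl : n = M + r := by lia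
    have h := tsum_zpow_mul_invQPochInt hp hp0 M (2 * r)
    rw [show (M : ℤ) + r - r = M by ring, show (M : ℤ) + r + r = M + 2 * r by ring, ← h,
      ← tsum_mul_left, ← tsum_int_shift _ r]
    refine tsum_congr fun k => ?_
    rw [show (M : ℤ) + r - (k + r) = M - k by ring, show k + r - r = k by ring,
      show k + r + r = k + 2 * r by ring,
      show 2 * ((k + r) * (k + r)) = 2 * (r * r) + 2 * (k * k + 2 * r * k) by ring, zpow_add₀ hp0]
    ring

/-- One step along the Bailey chain. -/
theorem baileyStep (hp : ‖p‖ < 1) (hp0 : p ≠ 0) {α β : ℤ → ℂ}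
    (h : ∀ s, ∑' r, α r * (invQPochInt (p ^ 2) (s - r) * invQPochInt (p ^ 2) (s + r)) = β s)
    (n : ℤ) :
    ∑' r, α r * p ^ (2 * (r * r)) * (invQPochInt (p ^ 2) (n - r) * invQPochInt (p ^ 2) (n + r)) =
      ∑' s, p ^ (2 * (s * s)) * (invQPochInt (p ^ 2) (n - s) * β s) := by
  set R := invQPochInt (p ^ 2) with hR
  have hs : Summable (Function.uncurry fun s r : ℤ =>
      α r * (p ^ (2 * (s * s)) * (R (n - s) * (R (s - r) * R (s + r))))) := by
    -- A nonzero term forces $|r|\le s\le n$.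
    refine summable_of_ne_finset_zero (s := Finset.Icc 0 n ×ˢ Finset.Icc (-n) n) ?_
    rintro ⟨s, r⟩ hsr
    simp only [Finset.mem_product, Finset.mem_Icc] at hsr
    have hc : n - s < 0 ∨ s - r < 0 ∨ s + r < 0 := by lia
    rcases hc with hc | hc | hc <;> simp [hR, invQPochInt_of_neg (p ^ 2) hc]
  have hc := hs.tsum_comm
  calc _ = ∑' r, ∑' s, α r * (p ^ (2 * (s * s)) * (R (n - s) * (R (s - r) * R (s + r)))) := by
        refine tsum_congr fun r => ?_
        rw [tsum_mul_left, tsum_zpow_mul_invQPochInt_sub_add hp hp0, mul_assoc]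
    _ = _ := hc
    _ = _ := by
        refine tsum_congr fun s => ?_
        rw [← h s, ← tsum_mul_left, ← tsum_mul_left]
        exact tsum_congr fun r => by ring

/-- The finite triple product at $x=1$, where $(1;p^2)_n=0$ for $n\ge1$. -/
theorem unitBaileyPair (hp : ‖p‖ < 1) (hp0 : p ≠ 0) (s : ℤ) :
    ∑' r : ℤ, (-1) ^ r * p ^ (r * r - r) *
        (invQPochInt (p ^ 2) (s - r) * invQPochInt (p ^ 2) (s + r)) =
      if s = 0 then 1 else 0 := by
  rcases lt_or_ge s 0 with hs | hs
  · rw [if_neg hs.ne]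
    refine (tsum_congr fun r => ?_).trans tsum_zero
    rcases lt_or_ge s r with h | h
    · simp [invQPochInt_of_neg _ (show s - r < 0 by lia)]
    · simp [invQPochInt_of_neg _ (show s + r < 0 by lia)]
  · obtain ⟨n, rfl⟩ := Int.eq_ofNat_of_zero_le hs
    rw [finiteJacobi hp hp0 one_ne_zero n n]
    cases n with
    | zero => simp [qPoch]
    | succ n =>
      have : qPoch 1 (p ^ 2) (n + 1) = 0 :=
        Finset.prod_eq_zero (Finset.mem_range.mpr n.succ_pos) (by simp)
      rw [this, if_neg (by lia)]
      simp

/-- Bressoud's finite form of the first Rogers–Ramanujan identity. -/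
theorem finiteRogersRamanujan (hp : ‖p‖ < 1) (hp0 : p ≠ 0) (n : ℤ) :
    ∑' r : ℤ, (-p ^ 4) ^ r * (p ^ 5) ^ (r * r - r) *
        (invQPochInt (p ^ 2) (n - r) * invQPochInt (p ^ 2) (n + r)) =
      ∑' s : ℤ, p ^ (2 * (s * s)) * (invQPochInt (p ^ 2) (n - s) * invQPochInt (p ^ 2) s) := by
  have h1 : ∀ n : ℤ, ∑' r : ℤ, (-1) ^ r * p ^ (r * r - r) * p ^ (2 * (r * r)) *
      (invQPochInt (p ^ 2) (n - r) * invQPochInt (p ^ 2) (n + r)) = invQPochInt (p ^ 2) n := by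
    intro n
    rw [baileyStep hp hp0 (unitBaileyPair hp hp0) n, tsum_eq_single 0 fun s hs => by simp [hs]]
    simp
  rw [← baileyStep hp hp0 h1 n]
  refine tsum_congr fun r => ?_
  congr 1
  -- Two steps add $4r^2$, and $(r^2-r)+4r^2=5(r^2-r)+4r$ is a triple product exponent with base
  -- $p^5$ and $x=p^4$.
  have e : (p ^ 4) ^ r * (p ^ 5) ^ (r * r - r) =
      p ^ (r * r - r) * p ^ (2 * (r * r)) * p ^ (2 * (r * r)) := by
    simp only [← zpow_natCast p 4, ← zpow_natCast p 5, ← zpow_mul, ← zpow_add₀ hp0]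
    congr 1; push_cast; ring
  rw [← neg_one_mul (p ^ 4), mul_zpow]
  linear_combination (-1) ^ r * e

theorem summable_norm_zpow_mul_self_mul_invQPochInt (hp : ‖p‖ < 1) :
    Summable fun s : ℤ => ‖p ^ (2 * (s * s)) * invQPochInt (p ^ 2) s‖ := by
  have hq := norm_pow_lt_one hp two_ne_zero
  obtain ⟨C, -, hC⟩ := exists_norm_invQPochInt_le hq
  refine Summable.of_nat_of_neg ?_ ?_
  · refine (summable_norm_pow_mul_pow_sq_mul (w := 1) hq
      (fun n => hC (n : ℤ))).congr fun n => ?_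
    rw [show 2 * ((n : ℤ) * n) = ((2 * n ^ 2 : ℕ) : ℤ) by push_cast; ring, zpow_natCast, pow_mul,
      one_pow, one_mul]
  · refine summable_of_ne_finset_zero (s := {0}) fun n hn => ?_
    rw [Finset.mem_singleton] at hn
    simp [invQPochInt_of_neg (p ^ 2) (show -(n : ℤ) < 0 by lia)]

theorem tsum_int_zpow_mul_self_mul_invQPochInt (p : ℂ) :
    ∑' s : ℤ, p ^ (2 * (s * s)) * invQPochInt (p ^ 2) s =
      ∑' n : ℕ, (p ^ 2) ^ n ^ 2 * (qPoch (p ^ 2) (p ^ 2) n)⁻¹ := by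
  rw [← Nat.cast_injective.tsum_eq (f := fun s : ℤ => p ^ (2 * (s * s)) * invQPochInt (p ^ 2) s)]
  · refine tsum_congr fun n => ?_
    rw [invQPochInt_natCast, show 2 * ((n : ℤ) * n) = ((2 * n ^ 2 : ℕ) : ℤ) by push_cast; ring,
      zpow_natCast, pow_mul]
  · intro s hs
    by_contra hc
    apply hs
    have : s < 0 := by
      by_contra h
      exact hc ⟨s.toNat, by lia⟩
    simp [invQPochInt_of_neg (p ^ 2) this]

theorem rogersRamanujan_of_ne_zero (hp : ‖p‖ < 1) (hp0 : p ≠ 0) :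
    qPochInf (p ^ 2) (p ^ 2) * ∑' n : ℕ, (p ^ 2) ^ n ^ 2 * (qPoch (p ^ 2) (p ^ 2) n)⁻¹ =
      qPochInf ((p ^ 2) ^ 2) ((p ^ 2) ^ 5) * qPochInf ((p ^ 2) ^ 3) ((p ^ 2) ^ 5) *
        qPochInf ((p ^ 2) ^ 5) ((p ^ 2) ^ 5) := by
  have hq := norm_pow_lt_one hp two_ne_zero
  have hp5 : ‖p ^ 5‖ < 1 := norm_pow_lt_one hp (by norm_num)
  have hp50 : p ^ 5 ≠ 0 := pow_ne_zero 5 hp0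
  have hp40 : p ^ 4 ≠ 0 := pow_ne_zero 4 hp0
  obtain ⟨C, hC0, hC⟩ := exists_norm_invQPochInt_le hq
  have h1 := tendsto_tsum_mul_invQPochInt hq (summable_norm_zpow_mul_zpow_mul_self hp5 hp50 (p ^ 4))
  rw [jacobiTripleProduct hp5 hp50 hp40] at h1
  have h2 : Tendsto (fun n : ℕ => ∑' s : ℤ, p ^ (2 * (s * s)) *
      (invQPochInt (p ^ 2) (n - s) * invQPochInt (p ^ 2) s)) atTop
      (𝓝 (∑' s : ℤ, p ^ (2 * (s * s)) * ((qPochInf (p ^ 2) (p ^ 2))⁻¹ * invQPochInt (p ^ 2) s))) := by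
    refine tendsto_tsum_of_dominated_convergence
      ((summable_norm_zpow_mul_self_mul_invQPochInt hp).mul_left C) (fun s => ?_)
      (Eventually.of_forall fun n s => ?_)
    · exact ((tendsto_invQPochInt_sub hq s).mul_const _).const_mul _
    · rw [mul_left_comm, norm_mul]
      exact mul_le_mul_of_nonneg_right (hC _) (norm_nonneg _)
  simp only [finiteRogersRamanujan hp hp0] at h1
  have h3 := tendsto_nhds_unique h1 h2
  simp only [mul_left_comm _ (qPochInf (p ^ 2) (p ^ 2))⁻¹] at h3
  rw [tsum_mul_left, tsum_int_zpow_mul_self_mul_invQPochInt] at h3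
  have h4 := qPochInf_ne_zero hq (one_sub_mul_pow_ne_zero hq hq)
  have e1 : (p ^ 5) ^ 2 / p ^ 4 = (p ^ 2) ^ 3 := by field_simp
  rw [e1, show (p ^ 5) ^ 2 = (p ^ 2) ^ 5 by ring, show p ^ 4 = (p ^ 2) ^ 2 by ring] at h3
  generalize ∑' n : ℕ, (p ^ 2) ^ n ^ 2 * (qPoch (p ^ 2) (p ^ 2) n)⁻¹ = S at h3 ⊢
  generalize qPochInf (p ^ 2) (p ^ 2) = A at h3 h4 ⊢
  generalize qPochInf ((p ^ 2) ^ 2) ((p ^ 2) ^ 5) * qPochInf ((p ^ 2) ^ 3) ((p ^ 2) ^ 5) *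
    qPochInf ((p ^ 2) ^ 5) ((p ^ 2) ^ 5) = B at h3 ⊢
  field_simp at h3
  linear_combination -h3

end Bailey

theorem qPochInf_zero_left (q : ℂ) : qPochInf 0 q = 1 := by simp [qPochInf]

/-- The first Rogers–Ramanujan identity, in product form. -/
theorem rogersRamanujan {q : ℂ} (hq : ‖q‖ < 1) :
    qPochInf q q * ∑' n : ℕ, q ^ n ^ 2 * (qPoch q q n)⁻¹ =
      qPochInf (q ^ 2) (q ^ 5) * qPochInf (q ^ 3) (q ^ 5) * qPochInf (q ^ 5) (q ^ 5) := by
  rcases eq_or_ne q 0 with rfl | hq0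
  · rw [tsum_eq_single 0 fun n hn => by simp [hn]]
    simp [qPochInf_zero_left, qPoch_zero]
  -- A square root of $q$ supplies the base $p$; $q=0$ is split off because negative powers of $p$
  -- occur.
  · obtain ⟨p, rfl⟩ := IsAlgClosed.exists_pow_nat_eq q two_pos
    have hp0 : p ≠ 0 := by rintro rfl; simp at hq0
    refine rogersRamanujan_of_ne_zero ?_ hp0
    rw [norm_pow] at hq
    exact lt_of_pow_lt_pow_left₀ 2 zero_le_one (by simpa using hq)

/-! ### Convergence, product dissections and assembly. -/

section Transformation

variable {q z : ℂ}

theorem summable_pow_three_mul_sq (hq : ‖q‖ < 1) (hz : ∀ k : ℕ, 1 - z * q * (q ^ 2) ^ k ≠ 0) :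
    Summable fun n : ℕ =>
      z ^ n * q ^ (3 * n ^ 2) / (qPoch (z * q) (q ^ 2) n * qPoch (q ^ 4) (q ^ 4) n) := by
  have hq2 := norm_pow_lt_one hq two_ne_zero
  have hq4 := norm_pow_lt_one hq four_ne_zero
  obtain ⟨C, -, hC⟩ := exists_norm_inv_qPoch_le hq4 (one_sub_mul_pow_ne_zero hq4 hq4)
  obtain ⟨D, -, hD⟩ := exists_norm_inv_qPoch_le hq2 hz
  refine (summable_norm_mul_of_bounded (summable_norm_pow_mul_pow_sq_mul (w := z)
    (norm_pow_lt_one hq three_ne_zero) hC) hD).of_norm.congr fun n => ?_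
  rw [div_eq_mul_inv, mul_inv, pow_mul]
  ring

theorem summable_pow_sq_add_self (hq : ‖q‖ < 1) (hz : ∀ k : ℕ, 1 - z * q * (q ^ 2) ^ k ≠ 0) :
    Summable fun n : ℕ =>
      q ^ (n ^ 2 + n) / (qPoch (z * q) (q ^ 2) n * qPoch (q ^ 2) (q ^ 2) n) := by
  have hq2 := norm_pow_lt_one hq two_ne_zero
  obtain ⟨C, -, hC⟩ := exists_norm_inv_qPoch_le hq2 (one_sub_mul_pow_ne_zero hq2 hq2)
  obtain ⟨D, -, hD⟩ := exists_norm_inv_qPoch_le hq2 hz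
  refine (summable_norm_mul_of_bounded (summable_norm_pow_mul_pow_sq_mul (w := q)
    hq hC) hD).of_norm.congr fun n => ?_
  rw [div_eq_mul_inv, mul_inv, pow_add]
  ring

theorem summable_pow_sq_div (hq : ‖q‖ < 1) (z : ℂ) :
    Summable fun n : ℕ => z ^ n * q ^ (n ^ 2) / qPoch (q ^ 4) (q ^ 4) n := by
  have hq4 := norm_pow_lt_one hq four_ne_zero
  obtain ⟨C, -, hC⟩ := exists_norm_inv_qPoch_le hq4 (one_sub_mul_pow_ne_zero hq4 hq4)
  exact (summable_norm_pow_mul_pow_sq_mul (w := z) hq hC).of_norm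

end Transformation

theorem qPochInf_self_eq_mul_five {q : ℂ} (hq : ‖q‖ < 1) :
    qPochInf q q = qPochInf q (q ^ 5) * qPochInf (q ^ 2) (q ^ 5) * qPochInf (q ^ 3) (q ^ 5) *
      qPochInf (q ^ 4) (q ^ 5) * qPochInf (q ^ 5) (q ^ 5) := by
  rw [qPochInf_eq_prod q hq (m := 5) (by norm_num)]
  simp only [Finset.prod_range_succ, Finset.prod_range_zero, one_mul, ← pow_succ']
  norm_num

theorem qPochInf_eq_mul_two (a : ℂ) {q : ℂ} (hq : ‖q‖ < 1) :
    qPochInf a q = qPochInf a (q ^ 2) * qPochInf (a * q) (q ^ 2) := by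
  rw [qPochInf_eq_prod a hq (m := 2) (by norm_num)]
  simp [Finset.prod_range_succ]

theorem mainTheorem10 (q : ℂ) (hq : ‖q‖ < 1) :
    -- the two transformations, for every `z` for which no factor `1 - z q^(2k+1)` vanishes
    (∀ z : ℂ, (∀ k : ℕ, 1 - z * q * (q ^ 2) ^ k ≠ 0) →
      Summable (fun n : ℕ =>
        z ^ n * q ^ (3 * n ^ 2) / (qPoch (z * q) (q ^ 2) n * qPoch (q ^ 4) (q ^ 4) n)) ∧
      Summable (fun n : ℕ =>
        q ^ (n ^ 2 + n) / (qPoch (z * q) (q ^ 2) n * qPoch (q ^ 2) (q ^ 2) n)) ∧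
      Summable (fun n : ℕ => (-z) ^ n * q ^ (n ^ 2) / qPoch (q ^ 4) (q ^ 4) n) ∧
      (∑' n : ℕ,
          z ^ n * q ^ (3 * n ^ 2) / (qPoch (z * q) (q ^ 2) n * qPoch (q ^ 4) (q ^ 4) n)
        = 1 / qPochInf (-q ^ 2) (q ^ 2) *
          ∑' n : ℕ, q ^ (n ^ 2 + n) / (qPoch (z * q) (q ^ 2) n * qPoch (q ^ 2) (q ^ 2) n)) ∧
      (1 / qPochInf (-q ^ 2) (q ^ 2) *
          ∑' n : ℕ, q ^ (n ^ 2 + n) / (qPoch (z * q) (q ^ 2) n * qPoch (q ^ 2) (q ^ 2) n)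
        = 1 / qPochInf (z * q) (q ^ 2) *
          ∑' n : ℕ, (-z) ^ n * q ^ (n ^ 2) / qPoch (q ^ 4) (q ^ 4) n)) ∧
    -- Rogers' identity
    HasSum (fun n : ℕ => q ^ (n ^ 2) / qPoch (q ^ 4) (q ^ 4) n)
      (1 / (qPochInf (-q ^ 2) (q ^ 2) * (qPochInf q (q ^ 5) * qPochInf (q ^ 4) (q ^ 5)))) ∧
    -- the case `z = -1`, with its successive product sides
    HasSum (fun n : ℕ =>
        (-1) ^ n * q ^ (3 * n ^ 2) / (qPoch (-q) (q ^ 2) n * qPoch (q ^ 4) (q ^ 4) n))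
      (1 / ((qPochInf (-q) (q ^ 2) * qPochInf (-q ^ 2) (q ^ 2)) *
        (qPochInf q (q ^ 5) * qPochInf (q ^ 4) (q ^ 5)))) ∧
    1 / ((qPochInf (-q) (q ^ 2) * qPochInf (-q ^ 2) (q ^ 2)) *
        (qPochInf q (q ^ 5) * qPochInf (q ^ 4) (q ^ 5)))
      = 1 / (qPochInf (-q) q * (qPochInf q (q ^ 5) * qPochInf (q ^ 4) (q ^ 5))) ∧
    1 / (qPochInf (-q) q * (qPochInf q (q ^ 5) * qPochInf (q ^ 4) (q ^ 5)))
      = qPochInf q q /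
        (qPochInf (q ^ 2) (q ^ 2) * (qPochInf q (q ^ 5) * qPochInf (q ^ 4) (q ^ 5))) ∧
    qPochInf q q /
        (qPochInf (q ^ 2) (q ^ 2) * (qPochInf q (q ^ 5) * qPochInf (q ^ 4) (q ^ 5)))
      = (qPochInf (q ^ 2) (q ^ 5) * qPochInf (q ^ 3) (q ^ 5) * qPochInf (q ^ 5) (q ^ 5)) /
        qPochInf (q ^ 2) (q ^ 2) := by
  have hq2 := norm_pow_lt_one hq two_ne_zero
  have hq5 : ‖q ^ 5‖ < 1 := norm_pow_lt_one hq (by norm_num)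
  have hpow : ∀ m : ℕ, m ≠ 0 → qPochInf (q ^ m) (q ^ 5) ≠ 0 := fun m hm =>
    qPochInf_ne_zero hq5 (one_sub_mul_pow_ne_zero hq5 (norm_pow_lt_one hq hm))
  have h1 : qPochInf q (q ^ 5) ≠ 0 := by simpa using hpow 1 one_ne_zero
  have h2 := hpow 2 (by norm_num)
  have h3 := hpow 3 (by norm_num)
  have h4 := hpow 4 (by norm_num)
  have h5 := hpow 5 (by norm_num)
  have hqq : qPochInf q q ≠ 0 := qPochInf_ne_zero hq (one_sub_mul_pow_ne_zero hq hq)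
  have hq22 : qPochInf (q ^ 2) (q ^ 2) ≠ 0 :=
    qPochInf_ne_zero hq2 (one_sub_mul_pow_ne_zero hq2 hq2)
  have hn2 : qPochInf (-q ^ 2) (q ^ 2) ≠ 0 :=
    qPochInf_ne_zero hq2 (one_sub_mul_pow_ne_zero hq2 (by rwa [norm_neg]))
  have hz1 : ∀ k : ℕ, 1 - -1 * q * (q ^ 2) ^ k ≠ 0 :=
    one_sub_mul_pow_ne_zero hq2 (by simpa using hq)
  have hn1 : qPochInf (-q) (q ^ 2) ≠ 0 := by simpa using qPochInf_ne_zero hq2 hz1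
  have hnq : qPochInf (-q) q ≠ 0 :=
    qPochInf_ne_zero hq (one_sub_mul_pow_ne_zero hq (by rwa [norm_neg]))
  have hfive := qPochInf_self_eq_mul_five hq
  have heven : qPochInf (-q) q = qPochInf (-q) (q ^ 2) * qPochInf (-q ^ 2) (q ^ 2) := by
    rw [qPochInf_eq_mul_two (-q) hq, show -q * q = -q ^ 2 by ring]
  have hneg := qPochInf_mul_neg q hq
  have hrogers : ∑' n : ℕ, q ^ (n ^ 2) / qPoch (q ^ 4) (q ^ 4) n =
      1 / (qPochInf (-q ^ 2) (q ^ 2) * (qPochInf q (q ^ 5) * qPochInf (q ^ 4) (q ^ 5))) := by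
    have hr := rogersRamanujan hq
    rw [← qPochInf_mul_tsum_pow_sq_div hq, hfive] at hr
    rw [eq_div_iff (mul_ne_zero hn2 (mul_ne_zero h1 h4))]
    -- These factors are common to $(q;q)_\infty$, split modulo 5, and the Rogers–Ramanujan product,
    -- leaving $(q,q^4;q^5)_\infty$.
    apply mul_left_cancel₀ (mul_ne_zero (mul_ne_zero h2 h3) h5)
    linear_combination hr
  refine ⟨fun z hz => ⟨summable_pow_three_mul_sq hq hz, summable_pow_sq_add_self hq hz,
    summable_pow_sq_div hq (-z), ?_, ?_⟩, ?_, ?_, ?_, ?_, ?_⟩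
  · have hne := qPochInf_ne_zero hq2 hz
    apply mul_left_cancel₀ hne
    rw [qPochInf_mul_tsum_pow_three_mul_sq hq hz, mul_left_comm,
      qPochInf_mul_tsum_pow_sq_add_self hq hz, one_div, inv_mul_cancel_left₀ hn2]
  · have hne := qPochInf_ne_zero hq2 hz
    apply mul_left_cancel₀ hne
    rw [mul_left_comm, qPochInf_mul_tsum_pow_sq_add_self hq hz, one_div, one_div,
      inv_mul_cancel_left₀ hn2, mul_inv_cancel_left₀ hne]
  · rw [← hrogers]
    simpa using (summable_pow_sq_div hq 1).hasSum
  · have hs := (summable_pow_three_mul_sq hq hz1).hasSum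
    have ht := qPochInf_mul_tsum_pow_three_mul_sq hq hz1
    simp only [neg_neg, one_pow, one_mul, hrogers, neg_one_mul q] at hs ht
    convert hs using 1
    apply mul_left_cancel₀ hn1
    rw [ht]
    field_simp
  · rw [heven]
  · rw [← hneg]
    field_simp
  · rw [hfive]
    field_simp
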